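/- For $n\ge 0$ put $(a;q)_n=\prod_{i=0}^{n-1}(1-aq^i)$. For integers $L,a$ let $\begin{bmatrix}L\\a\end{bmatrix}_q=\dfrac{(q;q)_L}{(q;q)_a(q;q)_{L-a}}$ if $0\le a\le L$, and $\begin{bmatrix}L\\a\end{bmatrix}_q=0$ otherwise. Let $q$ be a nonzero element, not a root of unity, of a field $K$ (for instance an indeterminate over $\mathbb{Q}$). Then for all integers $L$ and $j$ $$\sum_{\substack{r=0\\ r\equiv j\,(2)}}^{L} q^{L-r}(-q^{-1};q^2)_{L-r}\begin{bmatrix}L\\r\end{bmatrix}_{q^2}\begin{bmatrix}r\\ \frac12(r-j)\end{bmatrix}_{q^4}=\begin{bmatrix}2L\\L-j\end{bmatrix}_q ,$$ and, if the characteristic of $K$ is not $2$, $$\sum_{\substack{r=0\\ r\equiv j\,(2)}}^{L} \frac{q^{r}}{1+q^{2r}}\,(-q;q^2)_{L-r}\begin{bmatrix}L\\r\end{bmatrix}_{q^2}\begin{bmatrix}r\\ \frac12(r-j)\end{bmatrix}_{q^4}=\frac{q^{j}}{1+q^{2j}}\begin{bmatrix}2L\\L-j\end{bmatrix}_q$$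 (for $L<0$ the sums are empty). Moreover, when $q$ is an indeterminate over $\mathbb{Q}$, for all integers $0\le r\le L$ the kernel $q^{L-r}(-q^{-1};q^2)_{L-r}\begin{bmatrix}L\\r\end{bmatrix}_{q^2}$ of the first transformation and the factor $(-q;q^2)_{L-r}\begin{bmatrix}L\\r\end{bmatrix}_{q^2}$ of the kernel of the second (which is this factor times $\frac{q^r}{1+q^{2r}}$) are polynomials in $q$ with nonnegative integer coefficients. -/

import Mathlib

open Polynomial

/-- The `q`-shifted factorial `(a;q)_n = ∏_{i=0}^{n-1} (1 - a q^i)`. -/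
def qPoch {K : Type*} [Field K] (a q : K) (n : ℕ) : K :=
  ∏ i ∈ Finset.range n, (1 - a * q ^ i)

/-- The `q`-binomial coefficient `[L, a]_q` for integers `L` and `a`:
`(q;q)_L / ((q;q)_a (q;q)_{L-a})` if `0 ≤ a ≤ L`, and `0` otherwise. -/
def qBinom {K : Type*} [Field K] (q : K) (L a : ℤ) : K :=
  if 0 ≤ a ∧ a ≤ L then
    qPoch q q L.toNat / (qPoch q q a.toNat * qPoch q q (L - a).toNat)
  else 0

/-- The integers `r` with `0 ≤ r ≤ L` and `r ≡ j (mod 2)`. -/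
noncomputable def parityRange (L j : ℤ) : Finset ℤ :=
  (Finset.Icc 0 L).filter fun r => r ≡ j [ZMOD 2]

/-- The rational function `f ∈ ℚ(q)` is a polynomial in `q` with nonnegative
integer coefficients. -/
def IsNonnegPoly (f : RatFunc ℚ) : Prop :=
  ∃ P : ℕ[X], f = algebraMap ℚ[X] (RatFunc ℚ) (P.map (Nat.castRingHom ℚ))

/-!
Write `w r j = [r, (r - j) / 2]_{q⁴}` (zero if `r` and `j` have different parity) and
`u L j = [2L, L - j]_q`. The `w r j` are the coefficients of `z ^ j` in the continuous `q`-Hermite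
polynomial of degree `r` in base `q⁴`, and the `u L j` those of the one of degree `2L` in base `q`
at `z ^ (1/2)`. Hence multiplication by `z + z⁻¹` acts on both families by a three-term recurrence
(`IsGeneric.hermiteCoeff_shift`, `IsGeneric.centralBinom_recurrence`), and the first transformation
says that its kernel expands one family in the other. It follows by induction on `L`, because the
kernel satisfies the recurrence that the two others impose (`IsGeneric.plainKernel_recurrence`).

For the second transformation let `D` be multiplication of the `j`-th coefficient by
`q ^ j + q ^ (-j)`. Then `D u L` is a combination of `u L` and `u (L - 1)`
(`IsGeneric.mul_centralBinom`) and `D² w r` one of `w r` and `w (r - 2)`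
(`IsGeneric.sq_mul_hermiteCoeff`). If `f L` is the left-hand side of the second transformation, the
claim is `D f L = u L`, or equivalently `D² f L = D u L`, as `D` is invertible. Both sides are
expanded in the `w r`, the right one by the first transformation, and the coefficients agree
(`IsGeneric.twistedKernel_relation`).

Throughout, `1 / (q;q)_n` is extended by zero to negative `n`, so that
`1 / (q;q)_{n-1} = (1 - q ^ n) / (q;q)_n` holds at all integers, and most boundary cases disappear.

The nonnegativity follows from the Pascal rule for Gaussian binomials and the relation
`q ^ (n+1) (-q⁻¹;q²)_{n+1} = (q ^ (n+1) + q ^ n) (-q;q²)_n`.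
-/

/-! ### `q`-factorials and Gaussian binomials with integer arguments -/

section QFactorials

variable {K : Type*} [Field K] {q : K}

/-- The property that `q` is neither zero nor a root of unity. -/
def IsGeneric (q : K) : Prop := q ≠ 0 ∧ ∀ n : ℕ, 0 < n → q ^ n ≠ 1

lemma IsGeneric.pow (h : IsGeneric q) {m : ℕ} (hm : 0 < m) : IsGeneric (q ^ m) :=
  ⟨pow_ne_zero _ h.1, fun n hn => by rw [← pow_mul]; exact h.2 _ (Nat.mul_pos hm hn)⟩

lemma IsGeneric.zpow_ne_one (h : IsGeneric q) {m : ℤ} (hm : m ≠ 0) : q ^ m ≠ 1 := by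
  intro h1
  refine h.2 m.natAbs (Int.natAbs_pos.mpr hm) ?_
  rcases Int.natAbs_eq m with h2 | h2 <;> rw [h2] at h1
  · exact_mod_cast h1
  · rw [zpow_neg, inv_eq_one] at h1
    exact_mod_cast h1

lemma IsGeneric.one_sub_zpow_ne_zero (h : IsGeneric q) {m : ℤ} (hm : m ≠ 0) : 1 - q ^ m ≠ 0 :=
  sub_ne_zero.mpr (h.zpow_ne_one hm).symm

lemma IsGeneric.one_add_zpow_ne_zero (h : IsGeneric q) {m : ℤ} (hm : m ≠ 0) :
    1 + q ^ m ≠ 0 := by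
  intro h1
  refine h.zpow_ne_one (m := m * 2) (by omega) ?_
  rw [zpow_mul]
  have : q ^ m = -1 := by linear_combination h1
  rw [this]
  norm_num

/-- `(q;q)_n` for an integer `n`; it equals `1` for `n < 0`. -/
def qFac (q : K) (n : ℤ) : K := qPoch q q n.toNat

/-- The reciprocal `1 / (q;q)_n`, extended by zero to `n < 0`. With this convention
`qFacInv_sub_one` holds for every integer `n`. -/
def qFacInv (q : K) (n : ℤ) : K := if 0 ≤ n then (qFac q n)⁻¹ else 0

lemma toNat_add_one {n : ℤ} (hn : 0 ≤ n) : (n + 1).toNat = n.toNat + 1 := by omega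

lemma qPoch_toNat_add_one (a q : K) {n : ℤ} (hn : 0 ≤ n) :
    qPoch a q (n + 1).toNat = qPoch a q n.toNat * (1 - a * q ^ n) := by
  lift n to ℕ using hn
  rw [toNat_add_one (by positivity), qPoch, Finset.prod_range_succ]
  simp [qPoch]

lemma IsGeneric.qFac_add_one (h : IsGeneric q) {n : ℤ} (hn : 0 ≤ n) :
    qFac q (n + 1) = (1 - q ^ (n + 1)) * qFac q n := by
  rw [qFac, qPoch_toNat_add_one _ _ hn, zpow_add_one₀ h.1, qFac]
  ring

lemma IsGeneric.qFac_ne_zero (h : IsGeneric q) (n : ℤ) : qFac q n ≠ 0 := by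
  unfold qFac qPoch
  refine Finset.prod_ne_zero_iff.mpr fun i _ => ?_
  rw [← pow_succ', sub_ne_zero]
  exact (h.2 _ i.succ_pos).symm

lemma qFacInv_of_neg {n : ℤ} (hn : n < 0) : qFacInv q n = 0 := if_neg (by omega)

@[simp] lemma qFac_zero : qFac q 0 = 1 := by simp [qFac, qPoch]

@[simp] lemma qFacInv_zero : qFacInv q 0 = 1 := by simp [qFacInv]

lemma IsGeneric.qFacInv_sub_one (h : IsGeneric q) (n : ℤ) :
    qFacInv q (n - 1) = (1 - q ^ n) * qFacInv q n := by
  rcases lt_trichotomy n 0 with hn | rfl | hn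
  · rw [qFacInv_of_neg hn, qFacInv_of_neg (by omega), mul_zero]
  · simp [qFacInv_of_neg]
  · obtain ⟨m, rfl⟩ : ∃ m, n = m + 1 := ⟨n - 1, by ring⟩
    have hm : 0 ≤ m := by omega
    rw [add_sub_cancel_right, qFacInv, qFacInv, if_pos hm, if_pos hn.le, h.qFac_add_one hm]
    have h1 := h.qFac_ne_zero m
    have h2 := h.one_sub_zpow_ne_zero hn.ne'
    field_simp

/-- A product of two reciprocals with negative total index vanishes. -/
lemma qFacInv_mul_eq_zero {a b : ℤ} (hab : a + b < 0) : qFacInv q a * qFacInv q b = 0 := by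
  rcases lt_or_ge a 0 with ha | ha
  · rw [qFacInv_of_neg ha, zero_mul]
  · rw [qFacInv_of_neg (n := b) (by omega), mul_zero]

/-- Lowering the index of `qFac` by one. At `m = 0`, where `qFac q (-1) = 1` breaks the recursion,
both sides vanish because `a + b < 0`. -/
lemma IsGeneric.qFac_sub_one_mul (h : IsGeneric q) {m a b : ℤ} (hm : 0 ≤ m)
    (hab : a + b = m - 1) :
    (1 - q ^ m) * (qFac q (m - 1) * qFacInv q a * qFacInv q b) =
      qFac q m * qFacInv q a * qFacInv q b := by
  rcases hm.eq_or_lt with rfl | hm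
  · simp [mul_assoc, qFacInv_mul_eq_zero (q := q) (a := a) (b := b) (by omega)]
  · have := h.qFac_add_one (n := m - 1) (by omega)
    rw [sub_add_cancel] at this
    rw [this]
    ring

lemma IsGeneric.qFac_sub_two_mul (h : IsGeneric q) {m a b : ℤ} (hm : 0 ≤ m)
    (hab : a + b = m - 2) :
    (1 - q ^ m) * (1 - q ^ (m - 1)) * (qFac q (m - 2) * qFacInv q a * qFacInv q b) =
      qFac q m * qFacInv q a * qFacInv q b := by
  rcases le_or_gt m 1 with hm1 | hm1
  · simp [mul_assoc, qFacInv_mul_eq_zero (q := q) (a := a) (b := b) (by omega)]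
  · have h1 := h.qFac_add_one (n := m - 1) (by omega)
    have h2 := h.qFac_add_one (n := m - 2) (by omega)
    rw [sub_add_cancel] at h1
    rw [show m - 2 + 1 = m - 1 by ring] at h2
    rw [h1, h2]
    ring

lemma qBinom_eq_qFac (q : K) (L a : ℤ) :
    qBinom q L a = qFac q L * qFacInv q a * qFacInv q (L - a) := by
  unfold qBinom
  split_ifs with h
  · rw [qFacInv, qFacInv, if_pos h.1, if_pos (by omega)]
    simp only [qFac]
    rw [div_eq_mul_inv, mul_inv, mul_assoc]
  · rw [not_and_or] at h
    rcases h with h | h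
    · rw [qFacInv_of_neg (n := a) (by omega)]; ring
    · rw [qFacInv_of_neg (n := L - a) (by omega)]; ring

/-- The Pascal rule for Gaussian binomials. -/
lemma IsGeneric.qBinom_add_one (h : IsGeneric q) {L : ℤ} (hL : 0 ≤ L) (a : ℤ) :
    qBinom q (L + 1) a = qBinom q L (a - 1) + q ^ a * qBinom q L a := by
  simp only [qBinom_eq_qFac, h.qFac_add_one hL]
  rw [show L - (a - 1) = L + 1 - a by ring, show L - a = L + 1 - a - 1 by ring,
    h.qFacInv_sub_one, h.qFacInv_sub_one]
  have : q ^ (L + 1) = q ^ a * q ^ (L + 1 - a) := by rw [← zpow_add₀ h.1]; congr 1; ring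
  rw [this]
  ring

end QFactorials

/-! ### Coefficients of continuous `q`-Hermite polynomials -/

section HermiteCoefficients

variable {K : Type*} [Field K] {q : K}

/-- The coefficient of `z ^ j` in the continuous `q`-Hermite polynomial of degree `r` in
`z + z⁻¹`, that is `[r, (r - j) / 2]_q` if `r ≡ j (mod 2)` and `0` otherwise. -/
noncomputable def hermiteCoeff (q : K) (r j : ℤ) : K :=
  if r ≡ j [ZMOD 2] then qBinom q r ((r - j) / 2) else 0

lemma hermiteCoeff_two_mul (q : K) (r s : ℤ) :
    hermiteCoeff q r (r - 2 * s) = qFac q r * qFacInv q s * qFacInv q (r - s) := by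
  rw [hermiteCoeff, if_pos (by rw [Int.ModEq]; omega), qBinom_eq_qFac]
  rw [show (r - (r - 2 * s)) / 2 = s by omega]

lemma hermiteCoeff_of_odd (q : K) {r j : ℤ} (h : (r - j) % 2 = 1) : hermiteCoeff q r j = 0 :=
  if_neg (by rw [Int.ModEq]; omega)

/-- The three-term recurrence of the continuous `q`-Hermite polynomials: multiplication by
`z + z⁻¹`. -/
lemma IsGeneric.hermiteCoeff_shift (h : IsGeneric q) {r : ℤ} (hr : 0 ≤ r) (j : ℤ) :
    hermiteCoeff q r (j - 1) + hermiteCoeff q r (j + 1) =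
      hermiteCoeff q (r + 1) j + (1 - q ^ r) * hermiteCoeff q (r - 1) j := by
  rcases Int.emod_two_eq_zero_or_one (r + 1 - j) with hp | hp
  · obtain ⟨s, hs⟩ : ∃ s, j = r + 1 - 2 * s := ⟨(r + 1 - j) / 2, by omega⟩
    have e1 : hermiteCoeff q r (j - 1) = qFac q r * qFacInv q s * qFacInv q (r - s) := by
      rw [← hermiteCoeff_two_mul]; congr 1; omega
    have e2 : hermiteCoeff q r (j + 1) =
        qFac q r * qFacInv q (s - 1) * qFacInv q (r - (s - 1)) := by
      rw [← hermiteCoeff_two_mul]; congr 1; omega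
    have e3 : hermiteCoeff q (r + 1) j =
        qFac q (r + 1) * qFacInv q s * qFacInv q (r + 1 - s) := by
      rw [← hermiteCoeff_two_mul]; congr 1
    have e4 : hermiteCoeff q (r - 1) j =
        qFac q (r - 1) * qFacInv q (s - 1) * qFacInv q (r - 1 - (s - 1)) := by
      rw [← hermiteCoeff_two_mul]; congr 1; omega
    rw [e1, e2, e3, e4, h.qFac_sub_one_mul hr (by ring), h.qFac_add_one hr,
      show r - (s - 1) = r + 1 - s by ring, show r - 1 - (s - 1) = r + 1 - s - 1 by ring,
      show r - s = r + 1 - s - 1 by ring, h.qFacInv_sub_one, h.qFacInv_sub_one]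
    have : q ^ (r + 1) = q ^ s * q ^ (r + 1 - s) := by rw [← zpow_add₀ h.1]; congr 1; ring
    rw [this]
    ring
  · rw [hermiteCoeff_of_odd, hermiteCoeff_of_odd, hermiteCoeff_of_odd, hermiteCoeff_of_odd] <;>
      first | omega | ring

/-- The square of the operator `D : f(z) ↦ f(qz) + f(z/q)`, which multiplies the coefficient of
`z ^ j` by `q ^ j + q ^ (-j)`, applied to the `q`-Hermite polynomials in base `q ^ 4`: only the
degrees `r` and `r - 2` occur. -/
lemma IsGeneric.sq_mul_hermiteCoeff (h : IsGeneric q) {r : ℤ} (hr : 0 ≤ r) (j : ℤ) :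
    (q ^ j + q ^ (-j)) ^ 2 * hermiteCoeff (q ^ 4) r j =
      q ^ (-2 * r) * ((1 + q ^ (2 * r)) ^ 2 * hermiteCoeff (q ^ 4) r j -
        (1 - q ^ (4 * r)) * (1 - q ^ (4 * r - 4)) * hermiteCoeff (q ^ 4) (r - 2) j) := by
  have hq := h.1
  have h4 : IsGeneric (q ^ 4) := h.pow (by norm_num)
  rcases Int.emod_two_eq_zero_or_one (r - j) with hp | hp
  · obtain ⟨s, rfl⟩ : ∃ s, j = r - 2 * s := ⟨(r - j) / 2, by omega⟩
    have e4 : hermiteCoeff (q ^ 4) (r - 2) (r - 2 * s) =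
        qFac (q ^ 4) (r - 2) * qFacInv (q ^ 4) (s - 1) * qFacInv (q ^ 4) (r - s - 1) := by
      rw [show r - s - 1 = r - 2 - (s - 1) by ring, ← hermiteCoeff_two_mul]; congr 1; omega
    have key := h4.qFac_sub_two_mul hr (a := s - 1) (b := r - s - 1) (by ring)
    have c (n : ℤ) : (q ^ 4) ^ n = q ^ (4 * n) := by rw [zpow_mul]; norm_cast
    rw [c, c, show 4 * (r - 1) = 4 * r - 4 by ring] at key
    rw [e4, key, h4.qFacInv_sub_one, h4.qFacInv_sub_one, hermiteCoeff_two_mul, c, c]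
    have hx : q ^ s ≠ 0 := zpow_ne_zero _ hq
    have hy : q ^ r ≠ 0 := zpow_ne_zero _ hq
    have p2 (n : ℤ) : q ^ (2 * n) = (q ^ n) ^ 2 := by rw [mul_comm, zpow_mul]; norm_cast
    have p4 (n : ℤ) : q ^ (4 * n) = (q ^ n) ^ 4 := by rw [mul_comm, zpow_mul]; norm_cast
    simp only [zpow_neg, neg_mul, p2, p4, zpow_sub₀ hq]
    field_simp
    ring
  · rw [hermiteCoeff_of_odd _ hp, hermiteCoeff_of_odd (r := r - 2) _ (by omega)]
    ring

/-- The numbers `[2L, L - j]_q` are the coefficients of the `q`-Hermite polynomial of degree `2L`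
in base `q`, taken at `z ^ (1/2)`; eliminating the odd degrees from its three-term recurrence gives
a recurrence in `L`. -/
lemma IsGeneric.centralBinom_recurrence (h : IsGeneric q) {L : ℤ} (hL : 0 ≤ L) (j : ℤ) :
    qBinom q (2 * (L + 1)) (L + 1 - j) =
      qBinom q (2 * L) (L - (j - 1)) + qBinom q (2 * L) (L - (j + 1)) +
        (q ^ (2 * L) + q ^ (2 * L + 1)) * qBinom q (2 * L) (L - j) -
        (1 - q ^ (2 * L)) * (1 - q ^ (2 * L - 1)) * qBinom q (2 * (L - 1)) (L - 1 - j) := by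
  have hq := h.1
  have key := h.qFac_sub_two_mul (m := 2 * L) (by omega) (a := L - 1 - j) (b := L - 1 + j)
    (by ring)
  have f1 := h.qFac_add_one (n := 2 * L) (by omega)
  have f2 := h.qFac_add_one (n := 2 * L + 1) (by omega)
  simp only [qBinom_eq_qFac]
  rw [show 2 * (L - 1) - (L - 1 - j) = L - 1 + j by ring, show 2 * (L - 1) = 2 * L - 2 by ring,
    key, show 2 * (L + 1) - (L + 1 - j) = L + 1 + j by ring,
    show 2 * (L + 1) = 2 * L + 1 + 1 by ring, f2, f1,
    show 2 * L - (L - (j - 1)) = L + j - 1 by ring,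
    show 2 * L - (L - (j + 1)) = L + 1 + j by ring,
    show 2 * L - (L - j) = L + j by ring,
    show L - (j - 1) = L + 1 - j by ring, show L - (j + 1) = L - j - 1 by ring,
    show L - 1 - j = L - j - 1 by ring, show L - 1 + j = L + j - 1 by ring,
    h.qFacInv_sub_one, h.qFacInv_sub_one, show L + j = L + 1 + j - 1 by ring,
    show L - j = L + 1 - j - 1 by ring, h.qFacInv_sub_one, h.qFacInv_sub_one]
  have hx : q ^ L ≠ 0 := zpow_ne_zero _ hq
  have hy : q ^ j ≠ 0 := zpow_ne_zero _ hq
  have p2 : q ^ (2 * L) = (q ^ L) ^ 2 := by rw [mul_comm, zpow_mul]; norm_cast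
  simp only [p2, zpow_sub₀ hq, zpow_add₀ hq, zpow_one]
  field_simp
  ring

/-- The operator `D`, multiplication by `q ^ j + q ^ (-j)`, on the central binomials
`[2L, L - j]_q`. -/
lemma IsGeneric.mul_centralBinom (h : IsGeneric q) {L : ℤ} (hL : 0 ≤ L) (j : ℤ) :
    (q ^ j + q ^ (-j)) * qBinom q (2 * L) (L - j) =
      q ^ (-L) * ((1 + q ^ (2 * L)) * qBinom q (2 * L) (L - j) -
        (1 - q ^ (2 * L)) * (1 - q ^ (2 * L - 1)) * qBinom q (2 * (L - 1)) (L - 1 - j)) := by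
  have hq := h.1
  have key := h.qFac_sub_two_mul (m := 2 * L) (by omega) (a := L - 1 - j) (b := L - 1 + j)
    (by ring)
  simp only [qBinom_eq_qFac]
  rw [show 2 * (L - 1) - (L - 1 - j) = L - 1 + j by ring, show 2 * (L - 1) = 2 * L - 2 by ring,
    key, show 2 * L - (L - j) = L + j by ring,
    show L - 1 - j = L - j - 1 by ring, show L - 1 + j = L + j - 1 by ring,
    h.qFacInv_sub_one, h.qFacInv_sub_one]
  have hx : q ^ L ≠ 0 := zpow_ne_zero _ hq
  have hy : q ^ j ≠ 0 := zpow_ne_zero _ hq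
  have p2 : q ^ (2 * L) = (q ^ L) ^ 2 := by rw [mul_comm, zpow_mul]; norm_cast
  simp only [p2, zpow_sub₀ hq, zpow_add₀ hq, zpow_neg]
  field_simp
  ring

end HermiteCoefficients

/-! ### Recurrences of the two kernels -/

section Kernels

variable {K : Type*} [Field K] {q : K}

/-- The factor of the first kernel depending on `n = L - r` only,
`q^n (-q⁻¹;q²)_n / (q²;q²)_n`, extended by zero to `n < 0`. -/
def plainWeight (q : K) (n : ℤ) : K :=
  q ^ n * qPoch (-q⁻¹) (q ^ 2) n.toNat * qFacInv (q ^ 2) n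

/-- The factor of the second kernel depending on `n = L - r` only, `(-q;q²)_n / (q²;q²)_n`,
extended by zero to `n < 0`. -/
def twistedWeight (q : K) (n : ℤ) : K := qPoch (-q) (q ^ 2) n.toNat * qFacInv (q ^ 2) n

lemma sq_zpow (q : K) (n : ℤ) : (q ^ 2) ^ n = q ^ (2 * n) := by rw [zpow_mul]; norm_cast

lemma plainWeight_of_neg {n : ℤ} (hn : n < 0) : plainWeight q n = 0 := by
  rw [plainWeight, qFacInv_of_neg hn, mul_zero]

lemma twistedWeight_of_neg {n : ℤ} (hn : n < 0) : twistedWeight q n = 0 := by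
  rw [twistedWeight, qFacInv_of_neg hn, mul_zero]

lemma IsGeneric.plainWeight_add_one (h : IsGeneric q) (n : ℤ) :
    (1 - q ^ (2 * n + 2)) * plainWeight q (n + 1) = q * (1 + q ^ (2 * n - 1)) * plainWeight q n := by
  rcases lt_or_ge n 0 with hn | hn
  · rw [plainWeight_of_neg hn]
    rcases eq_or_ne n (-1) with rfl | hn'
    · simp
    · rw [plainWeight_of_neg (by omega)]; ring
  · have e := (h.pow (m := 2) (by norm_num)).qFacInv_sub_one (n + 1)
    rw [add_sub_cancel_right, sq_zpow, show 2 * (n + 1) = 2 * n + 2 by ring] at e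
    rw [plainWeight, plainWeight, e, qPoch_toNat_add_one _ _ hn, sq_zpow, zpow_add_one₀ h.1,
      zpow_sub_one₀ h.1]
    ring

lemma IsGeneric.twistedWeight_add_one (h : IsGeneric q) (n : ℤ) :
    (1 - q ^ (2 * n + 2)) * twistedWeight q (n + 1) = (1 + q ^ (2 * n + 1)) * twistedWeight q n := by
  rcases lt_or_ge n 0 with hn | hn
  · rw [twistedWeight_of_neg hn]
    rcases eq_or_ne n (-1) with rfl | hn'
    · simp
    · rw [twistedWeight_of_neg (by omega)]; ring
  · have e := (h.pow (m := 2) (by norm_num)).qFacInv_sub_one (n + 1)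
    rw [add_sub_cancel_right, sq_zpow, show 2 * (n + 1) = 2 * n + 2 by ring] at e
    rw [twistedWeight, twistedWeight, e, qPoch_toNat_add_one _ _ hn, sq_zpow, zpow_add_one₀ h.1]
    ring

lemma qPoch_succ_left (a q : K) (n : ℕ) :
    qPoch a q (n + 1) = (1 - a) * qPoch (a * q) q n := by
  rw [qPoch, Finset.prod_range_succ', qPoch, mul_comm]
  simp [pow_succ', mul_assoc]

lemma qPoch_neg_inv_succ (hq : q ≠ 0) (n : ℕ) :
    qPoch (-q⁻¹) (q ^ 2) (n + 1) = (1 + q⁻¹) * qPoch (-q) (q ^ 2) n := by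
  rw [qPoch_succ_left, sub_neg_eq_add, show -q⁻¹ * q ^ 2 = -q by field_simp]

/-- The two weights differ by a rational factor, since
`(-q⁻¹;q²)_{n+1} = (1 + q⁻¹) (-q;q²)_n`. -/
lemma IsGeneric.plainWeight_mul (h : IsGeneric q) (n : ℤ) :
    (1 + q ^ (2 * n - 1)) * plainWeight q n = q ^ (n - 1) * (1 + q) * twistedWeight q n := by
  have hq := h.1
  rcases lt_or_ge n 0 with hn | hn
  · rw [plainWeight_of_neg hn, twistedWeight_of_neg hn]; ring
  · have e1 := qPoch_toNat_add_one (-q⁻¹) (q ^ 2) hn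
    rw [toNat_add_one hn, qPoch_neg_inv_succ hq, sq_zpow] at e1
    have hx : q ^ n ≠ 0 := zpow_ne_zero _ hq
    rw [zpow_sub_one₀ hq, zpow_sub_one₀ hq, plainWeight, twistedWeight]
    have : q ^ n * q⁻¹ * (1 + q) = q ^ n * (1 + q⁻¹) := by field_simp; ring
    rw [this]
    linear_combination -(q ^ n * qFacInv (q ^ 2) n) * e1

/-- The kernel `q^{L-r} (-q⁻¹;q²)_{L-r} [L, r]_{q²}` of the first transformation. -/
def plainKernel (q : K) (L r : ℤ) : K :=
  qFac (q ^ 2) L * qFacInv (q ^ 2) r * plainWeight q (L - r)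

/-- The kernel of the second transformation without the factor `q^r / (1 + q^{2r})`, that is
`(-q;q²)_{L-r} [L, r]_{q²}`. -/
def twistedKernel (q : K) (L r : ℤ) : K :=
  qFac (q ^ 2) L * qFacInv (q ^ 2) r * twistedWeight q (L - r)

lemma plainKernel_eq (q : K) (L r : ℤ) : plainKernel q L r =
    q ^ (L - r) * qPoch (-q⁻¹) (q ^ 2) (L - r).toNat * qBinom (q ^ 2) L r := by
  rw [plainKernel, plainWeight, qBinom_eq_qFac]; ring

lemma twistedKernel_eq (q : K) (L r : ℤ) : twistedKernel q L r =
    qPoch (-q) (q ^ 2) (L - r).toNat * qBinom (q ^ 2) L r := by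
  rw [twistedKernel, twistedWeight, qBinom_eq_qFac]; ring

lemma plainKernel_support {L r : ℤ} (h : plainKernel q L r ≠ 0) : 0 ≤ r ∧ r ≤ L := by
  contrapose! h
  rcases lt_or_ge r 0 with hr | hr
  · rw [plainKernel, qFacInv_of_neg hr]; ring
  · rw [plainKernel, plainWeight_of_neg (by have := h hr; omega), mul_zero]

lemma twistedKernel_support {L r : ℤ} (h : twistedKernel q L r ≠ 0) : 0 ≤ r ∧ r ≤ L := by
  contrapose! h
  rcases lt_or_ge r 0 with hr | hr
  · rw [twistedKernel, qFacInv_of_neg hr]; ring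
  · rw [twistedKernel, twistedWeight_of_neg (by have := h hr; omega), mul_zero]

lemma IsGeneric.plainKernel_sub_one (h : IsGeneric q) {L : ℤ} (hL : 0 ≤ L) (r : ℤ) :
    (1 - q ^ (2 * L)) * plainKernel q (L - 1) r =
      qFac (q ^ 2) L * qFacInv (q ^ 2) r * plainWeight q (L - 1 - r) := by
  have key := (h.pow (m := 2) (by norm_num)).qFac_sub_one_mul hL (a := r) (b := L - 1 - r)
    (by ring)
  rw [sq_zpow] at key
  rw [plainKernel, plainWeight]
  linear_combination (q ^ (L - 1 - r) * qPoch (-q⁻¹) (q ^ 2) (L - 1 - r).toNat) * key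

/-- The recurrence in `L` that makes `∑ r, plainKernel q L r * hermiteCoeff (q ^ 4) r j` satisfy the
recurrence `IsGeneric.centralBinom_recurrence`. -/
lemma IsGeneric.plainKernel_recurrence (h : IsGeneric q) {L : ℤ} (hL : 0 ≤ L) (r : ℤ) :
    plainKernel q (L + 1) r =
      plainKernel q L (r - 1) + (1 - q ^ (4 * (r + 1))) * plainKernel q L (r + 1) +
        (q ^ (2 * L) + q ^ (2 * L + 1)) * plainKernel q L r -
        (1 - q ^ (2 * L)) * (1 - q ^ (2 * L - 1)) * plainKernel q (L - 1) r := by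
  have hq := h.1
  have h2 : IsGeneric (q ^ 2) := h.pow (by norm_num)
  obtain ⟨n, rfl⟩ : ∃ n, L = r + n := ⟨L - r, by ring⟩
  have key := h.plainKernel_sub_one hL r
  have g1 := h2.qFacInv_sub_one r
  have g2 := h2.qFacInv_sub_one (r + 1)
  have k1 := h.plainWeight_add_one n
  have k2 := h.plainWeight_add_one (n - 1)
  have f := h2.qFac_add_one hL
  rw [add_sub_cancel_right] at g2
  rw [sub_add_cancel] at k2
  rw [sq_zpow] at g1 g2 f
  rw [mul_right_comm, key]
  simp only [plainKernel, f, g1]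
  rw [show r + n + 1 - r = n + 1 by ring, show r + n - (r - 1) = n + 1 by ring,
    show r + n - (r + 1) = n - 1 by ring, show r + n - r = n by ring,
    show r + n - 1 - r = n - 1 by ring]
  have hx : q ^ r ≠ 0 := zpow_ne_zero _ hq
  have hy : q ^ n ≠ 0 := zpow_ne_zero _ hq
  have p2 (n : ℤ) : q ^ (2 * n) = (q ^ n) ^ 2 := by rw [mul_comm, zpow_mul]; norm_cast
  have p4 (n : ℤ) : q ^ (4 * n) = (q ^ n) ^ 4 := by rw [mul_comm, zpow_mul]; norm_cast
  have c2 : q ^ (2 : ℤ) = q ^ 2 := by norm_cast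
  simp only [p2, p4, zpow_sub₀ hq, zpow_add₀ hq, zpow_one, c2] at g2 k1 k2 ⊢
  rw [g2]
  generalize q ^ r = R at *
  generalize q ^ n = N at *
  field_simp at k1 k2 ⊢
  linear_combination (R ^ 2 * qFac (q ^ 2) (r + n) * qFacInv (q ^ 2) (r + 1) *
    (1 - R ^ 2 * q ^ 2)) * (q * k1 + k2)

/-- The coefficient of `hermiteCoeff (q ^ 4) r j` in `D²` of the second sum agrees with that in `D`
of the first sum. -/
lemma IsGeneric.twistedKernel_relation (h : IsGeneric q) {L : ℤ} (hL : 0 ≤ L) (r : ℤ) :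
    q ^ (-r) * (1 + q ^ (2 * r)) * twistedKernel q L r -
        q ^ (-(r + 2)) * (1 - q ^ (2 * (r + 2))) * (1 - q ^ (4 * (r + 2) - 4)) *
          twistedKernel q L (r + 2) =
      q ^ (-L) * ((1 + q ^ (2 * L)) * plainKernel q L r -
        (1 - q ^ (2 * L)) * (1 - q ^ (2 * L - 1)) * plainKernel q (L - 1) r) := by
  have hq := h.1
  have h2 : IsGeneric (q ^ 2) := h.pow (by norm_num)
  obtain ⟨n, rfl⟩ : ∃ n, L = r + n := ⟨L - r, by ring⟩
  have key := h.plainKernel_sub_one hL r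
  have g1 := h2.qFacInv_sub_one (r + 1)
  have g2 := h2.qFacInv_sub_one (r + 2)
  have k0 := h.plainWeight_mul n
  have k1 := h.plainWeight_mul (n - 1)
  have m1 := h.twistedWeight_add_one (n - 1)
  have m2 := h.twistedWeight_add_one (n - 2)
  have d1 := h.one_add_zpow_ne_zero (m := 2 * n - 1) (by omega)
  have d2 := h.one_add_zpow_ne_zero (m := 2 * (n - 1) - 1) (by omega)
  rw [add_sub_cancel_right] at g1
  rw [show r + 2 - 1 = r + 1 by ring] at g2
  rw [sub_add_cancel] at m1
  rw [show n - 2 + 1 = n - 1 by ring] at m2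
  rw [g2, sq_zpow, sq_zpow] at g1
  rw [mul_right_comm (1 - q ^ (2 * (r + n))), key]
  simp only [plainKernel, twistedKernel, g1]
  rw [show r + n - (r + 2) = n - 2 by ring, show r + n - r = n by ring,
    show r + n - 1 - r = n - 1 by ring]
  -- These factors clear the denominators when all weights are expressed through one of them.
  refine mul_left_cancel₀ (mul_ne_zero d1 d2) ?_
  have hx : q ^ r ≠ 0 := zpow_ne_zero _ hq
  have hy : q ^ n ≠ 0 := zpow_ne_zero _ hq
  have p2 (n : ℤ) : q ^ (2 * n) = (q ^ n) ^ 2 := by rw [mul_comm, zpow_mul]; norm_cast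
  have p4 (n : ℤ) : q ^ (4 * n) = (q ^ n) ^ 4 := by rw [mul_comm, zpow_mul]; norm_cast
  have c2 : q ^ (2 : ℤ) = q ^ 2 := by norm_cast
  have c4 : q ^ (4 : ℤ) = q ^ 4 := by norm_cast
  simp only [p2, p4, zpow_sub₀ hq, zpow_add₀ hq, zpow_neg, zpow_one, c2, c4] at k0 k1 m1 m2 ⊢
  clear d1 d2 key g1 g2
  generalize q ^ r = R at *
  generalize q ^ n = N at *
  field_simp at k0 k1 m1 m2 ⊢
  linear_combination (qFac (q ^ 2) (r + n) * qFacInv (q ^ 2) (r + 2) * (1 - q ^ 4 * R ^ 2) *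
    (1 - q ^ 2 * R ^ 2)) * (N * (q + N ^ 2) * (1 + q ^ 2 * R ^ 2) * m2 -
      q ^ 2 * (q ^ 3 + N ^ 2) * (1 + N ^ 2 * R ^ 2) * k0 +
      q * (q + N ^ 2) * (q - N ^ 2 * R ^ 2) * k1 +
      N * q * (q ^ 3 + N ^ 2) * (q * R ^ 2 - 1) * m1)

end Kernels

/-! ### The two transformations -/

section Transformations

variable {K : Type*} [Field K] {q : K}

/-- Translation of the summation variable of a finitely supported sum over the integers. -/
lemma sum_Icc_shift (F : ℤ → K) {a b a' b' : ℤ} (c : ℤ)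
    (hF : ∀ r, F r ≠ 0 → (a ≤ r ∧ r ≤ b) ∧ (a' ≤ r - c ∧ r - c ≤ b')) :
    ∑ r ∈ Finset.Icc a b, F r = ∑ r ∈ Finset.Icc a' b', F (r + c) := by
  rw [← finsum_eq_sum_of_support_subset, ← finsum_eq_sum_of_support_subset]
  · exact (finsum_comp_equiv (Equiv.addRight c) (f := F)).symm
  · intro r hr
    have := hF (r + c) hr
    simp only [Finset.coe_Icc, Set.mem_Icc]
    omega
  · intro r hr
    have := hF r hr
    simpa using this.1

lemma hermiteCoeff_of_neg (q : K) {r : ℤ} (hr : r < 0) (j : ℤ) : hermiteCoeff q r j = 0 := by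
  unfold hermiteCoeff qBinom
  split_ifs
  · omega
  · rfl
  · rfl

lemma sum_parityRange (c : ℤ → K) (p : K) (L j : ℤ) :
    ∑ r ∈ parityRange L j, c r * qBinom p r ((r - j) / 2) =
      ∑ r ∈ Finset.Icc 0 L, c r * hermiteCoeff p r j := by
  rw [parityRange, Finset.sum_filter]
  refine Finset.sum_congr rfl fun r _ => ?_
  rw [hermiteCoeff, mul_ite, mul_zero]

/-- The left-hand side of the first transformation. -/
noncomputable def plainSum (q : K) (L j : ℤ) : K :=
  ∑ r ∈ Finset.Icc 0 L, plainKernel q L r * hermiteCoeff (q ^ 4) r j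

lemma pow_four_zpow (q : K) (n : ℤ) : (q ^ 4) ^ n = q ^ (4 * n) := by rw [zpow_mul]; norm_cast

lemma plainSum_eq_of_le (q : K) {L N : ℤ} (hN : L ≤ N) (j : ℤ) :
    plainSum q L j = ∑ r ∈ Finset.Icc 0 N, plainKernel q L r * hermiteCoeff (q ^ 4) r j := by
  refine (sum_Icc_shift (a' := 0) (b' := N) _ 0 fun r hr => ?_).trans (by simp only [add_zero])
  have := plainKernel_support (left_ne_zero_of_mul hr)
  omega

lemma IsGeneric.plainSum_recurrence (h : IsGeneric q) {L : ℤ} (hL : 0 ≤ L) (j : ℤ) :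
    plainSum q (L + 1) j =
      plainSum q L (j - 1) + plainSum q L (j + 1) +
        (q ^ (2 * L) + q ^ (2 * L + 1)) * plainSum q L j -
        (1 - q ^ (2 * L)) * (1 - q ^ (2 * L - 1)) * plainSum q (L - 1) j := by
  have h4 : IsGeneric (q ^ 4) := h.pow (by norm_num)
  have shift : plainSum q L (j - 1) + plainSum q L (j + 1) =
      ∑ r ∈ Finset.Icc 0 (L + 1), plainKernel q L (r - 1) * hermiteCoeff (q ^ 4) r j +
      ∑ r ∈ Finset.Icc 0 (L + 1), (1 - q ^ (4 * (r + 1))) * plainKernel q L (r + 1) *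
        hermiteCoeff (q ^ 4) r j := by
    rw [sum_Icc_shift (a' := 0) (b' := L)
        (fun r => plainKernel q L (r - 1) * hermiteCoeff (q ^ 4) r j) 1,
      sum_Icc_shift (a' := 0) (b' := L) (fun r => (1 - q ^ (4 * (r + 1))) *
        plainKernel q L (r + 1) * hermiteCoeff (q ^ 4) r j) (-1), plainSum, plainSum,
      ← Finset.sum_add_distrib, ← Finset.sum_add_distrib]
    · refine Finset.sum_congr rfl fun r hr => ?_
      have := h4.hermiteCoeff_shift (Finset.mem_Icc.mp hr).1 j
      rw [pow_four_zpow] at this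
      rw [add_sub_cancel_right, neg_add_cancel_right, ← sub_eq_add_neg]
      linear_combination plainKernel q L r * this
    · intro r hr
      have h1 := plainKernel_support (right_ne_zero_of_mul (left_ne_zero_of_mul hr))
      have h2 : 0 ≤ r := not_lt.mp fun hr0 => hr (by rw [hermiteCoeff_of_neg _ hr0, mul_zero])
      omega
    · intro r hr
      have h1 := plainKernel_support (left_ne_zero_of_mul hr)
      omega
  rw [shift, plainSum_eq_of_le q (show L ≤ L + 1 by omega) j,
    plainSum_eq_of_le q (show L - 1 ≤ L + 1 by omega) j, plainSum, Finset.mul_sum, Finset.mul_sum,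
    ← Finset.sum_add_distrib, ← Finset.sum_add_distrib, ← Finset.sum_sub_distrib]
  refine Finset.sum_congr rfl fun r _ => ?_
  rw [h.plainKernel_recurrence hL]
  ring

lemma qBinom_of_neg (q : K) {L : ℤ} (hL : L < 0) (a : ℤ) : qBinom q L a = 0 :=
  if_neg (by omega)

lemma plainSum_zero (q : K) (j : ℤ) : plainSum q 0 j = qBinom q 0 (-j) := by
  rw [plainSum, Finset.Icc_self, Finset.sum_singleton]
  have h1 : plainKernel q 0 0 = 1 := by simp [plainKernel, plainWeight, qPoch]
  rw [h1, one_mul]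
  unfold hermiteCoeff
  rcases eq_or_ne j 0 with rfl | hj
  · simp [qBinom, qPoch]
  · rw [qBinom, qBinom, if_neg (c := 0 ≤ -j ∧ -j ≤ 0) (by omega)]
    split_ifs with h2 h3
    · rw [Int.ModEq] at h2; omega
    · rfl
    · rfl

/-- The first transformation: both sides satisfy the same recurrence in `L`. -/
lemma IsGeneric.plainSum_eq (h : IsGeneric q) (L j : ℤ) :
    plainSum q L j = qBinom q (2 * L) (L - j) := by
  have neg {L : ℤ} (hL : L < 0) (j : ℤ) : plainSum q L j = qBinom q (2 * L) (L - j) := by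
    rw [qBinom_of_neg _ (by omega), plainSum, Finset.Icc_eq_empty (by omega), Finset.sum_empty]
  have nat (n : ℕ) : ∀ j, plainSum q n j = qBinom q (2 * n) (n - j) ∧
      plainSum q (n - 1) j = qBinom q (2 * (n - 1)) (n - 1 - j) := by
    induction n with
    | zero => exact fun j => ⟨by simp [plainSum_zero], neg (by simp) j⟩
    | succ n ih =>
      intro j
      push_cast
      rw [add_sub_cancel_right]
      refine ⟨?_, (ih j).1⟩
      rw [h.plainSum_recurrence n.cast_nonneg, h.centralBinom_recurrence n.cast_nonneg,
        (ih _).1, (ih _).1, (ih _).1, (ih _).2]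
  rcases lt_or_ge L 0 with hL | hL
  · exact neg hL j
  · lift L to ℕ using hL
    exact (nat L j).1

/-- The left-hand side of the second transformation. -/
noncomputable def twistedSum (q : K) (L j : ℤ) : K :=
  ∑ r ∈ Finset.Icc 0 L, q ^ r / (1 + q ^ (2 * r)) * twistedKernel q L r * hermiteCoeff (q ^ 4) r j

lemma IsGeneric.one_add_zpow_two_mul_ne_zero (h : IsGeneric q) (h2 : (2 : K) ≠ 0) (m : ℤ) :
    1 + q ^ (2 * m) ≠ 0 := by
  rcases eq_or_ne m 0 with rfl | hm
  · simpa [one_add_one_eq_two] using h2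
  · exact h.one_add_zpow_ne_zero (by omega)

/-- Applying `D²` to the second sum gives the expansion of `D [2L, L - j]_q` by means of the first
transformation. -/
lemma IsGeneric.sq_mul_twistedSum (h : IsGeneric q) (h2 : (2 : K) ≠ 0) {L : ℤ} (hL : 0 ≤ L) (j : ℤ) :
    (q ^ j + q ^ (-j)) ^ 2 * twistedSum q L j =
      q ^ (-L) * ((1 + q ^ (2 * L)) * plainSum q L j -
        (1 - q ^ (2 * L)) * (1 - q ^ (2 * L - 1)) * plainSum q (L - 1) j) := by
  have hq := h.1
  have shift := sum_Icc_shift (a := 0) (b := L) (a' := 0) (b' := L)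
    (fun r => q ^ (-(r + 2)) * (1 - q ^ (2 * (r + 2))) * (1 - q ^ (4 * (r + 2) - 4)) *
          twistedKernel q L (r + 2) * hermiteCoeff (q ^ 4) r j) (-2) (by
    intro r hr
    have h1 := twistedKernel_support (right_ne_zero_of_mul (left_ne_zero_of_mul hr))
    have h2 : 0 ≤ r := not_lt.mp fun hr0 => hr (by rw [hermiteCoeff_of_neg _ hr0, mul_zero])
    omega)
  -- The terms of degree `r - 2 < 0` drop out, as `hermiteCoeff` vanishes in negative degree.
  have expand : (q ^ j + q ^ (-j)) ^ 2 * twistedSum q L j =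
      ∑ r ∈ Finset.Icc 0 L, q ^ (-r) * (1 + q ^ (2 * r)) * twistedKernel q L r *
        hermiteCoeff (q ^ 4) r j -
      ∑ r ∈ Finset.Icc 0 L, q ^ (-(r + 2)) * (1 - q ^ (2 * (r + 2))) *
        (1 - q ^ (4 * (r + 2) - 4)) * twistedKernel q L (r + 2) * hermiteCoeff (q ^ 4) r j := by
    rw [shift, twistedSum, Finset.mul_sum, ← Finset.sum_sub_distrib]
    refine Finset.sum_congr rfl fun r hr => ?_
    have e := h.sq_mul_hermiteCoeff (Finset.mem_Icc.mp hr).1 j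
    have d := h.one_add_zpow_two_mul_ne_zero h2 r
    rw [neg_add_cancel_right, ← sub_eq_add_neg, mul_left_comm, e]
    have hx : q ^ r ≠ 0 := zpow_ne_zero _ hq
    have p2 (n : ℤ) : q ^ (2 * n) = (q ^ n) ^ 2 := by rw [mul_comm, zpow_mul]; norm_cast
    have p4 (n : ℤ) : q ^ (4 * n) = (q ^ n) ^ 4 := by rw [mul_comm, zpow_mul]; norm_cast
    rw [p2] at d
    simp only [p2, p4, zpow_sub₀ hq, zpow_neg, neg_mul]
    field_simp
    ring
  rw [expand, ← Finset.sum_sub_distrib, plainSum_eq_of_le q (show L - 1 ≤ L by omega) j, plainSum,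
    Finset.mul_sum, Finset.mul_sum, ← Finset.sum_sub_distrib, Finset.mul_sum]
  refine Finset.sum_congr rfl fun r _ => ?_
  rw [← sub_mul, h.twistedKernel_relation hL]
  ring

/-- The second transformation: `D` is multiplication by the nonzero number `q ^ j + q ^ (-j)`, so
one factor cancels. -/
lemma IsGeneric.twistedSum_eq (h : IsGeneric q) (h2 : (2 : K) ≠ 0) (L j : ℤ) :
    twistedSum q L j = q ^ j / (1 + q ^ (2 * j)) * qBinom q (2 * L) (L - j) := by
  rcases lt_or_ge L 0 with hL | hL
  · rw [qBinom_of_neg _ (by omega), twistedSum, Finset.Icc_eq_empty (by omega), Finset.sum_empty,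
      mul_zero]
  · have e := h.sq_mul_twistedSum h2 hL j
    rw [h.plainSum_eq, h.plainSum_eq, ← h.mul_centralBinom hL] at e
    have d := h.one_add_zpow_two_mul_ne_zero h2 j
    have hx : q ^ j ≠ 0 := zpow_ne_zero _ h.1
    have p2 : q ^ (2 * j) = (q ^ j) ^ 2 := by rw [mul_comm, zpow_mul]; norm_cast
    have d' : q ^ j + q ^ (-j) = (1 + q ^ (2 * j)) / q ^ j := by
      rw [p2, zpow_neg]; field_simp; ring
    rw [d'] at e
    field_simp at e ⊢
    linear_combination e

end Transformations

/-! ### Nonnegativity of the kernels -/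

section Nonnegativity

lemma isNonnegPoly_X_pow (n : ℕ) : IsNonnegPoly ((RatFunc.X : RatFunc ℚ) ^ n) :=
  ⟨X ^ n, by simp⟩

lemma isNonnegPoly_zero : IsNonnegPoly 0 := ⟨0, by simp⟩

lemma isNonnegPoly_one : IsNonnegPoly 1 := ⟨1, by simp⟩

lemma IsNonnegPoly.add {f g : RatFunc ℚ} (hf : IsNonnegPoly f) (hg : IsNonnegPoly g) :
    IsNonnegPoly (f + g) := by
  obtain ⟨P, rfl⟩ := hf
  obtain ⟨Q, rfl⟩ := hg
  exact ⟨P + Q, by simp⟩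

lemma IsNonnegPoly.mul {f g : RatFunc ℚ} (hf : IsNonnegPoly f) (hg : IsNonnegPoly g) :
    IsNonnegPoly (f * g) := by
  obtain ⟨P, rfl⟩ := hf
  obtain ⟨Q, rfl⟩ := hg
  exact ⟨P * Q, by simp⟩

lemma isGeneric_X : IsGeneric (RatFunc.X : RatFunc ℚ) := by
  refine ⟨RatFunc.X_ne_zero (K := ℚ), fun n hn h => ?_⟩
  have h1 : algebraMap ℚ[X] (RatFunc ℚ) (X ^ n) = algebraMap ℚ[X] (RatFunc ℚ) 1 := by
    simpa using h
  have h0 : (X ^ n : ℚ[X]) = 1 := RatFunc.algebraMap_injective ℚ h1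
  have h2 := congrArg natDegree h0
  simp at h2
  omega

lemma isNonnegPoly_qBinom {m : ℕ} (hm : 0 < m) (L a : ℤ) :
    IsNonnegPoly (qBinom ((RatFunc.X : RatFunc ℚ) ^ m) L a) := by
  rcases lt_or_ge L 0 with hL | hL
  · rw [qBinom_of_neg _ hL]; exact isNonnegPoly_zero
  · lift L to ℕ using hL
    induction L generalizing a with
    | zero =>
      rcases eq_or_ne a 0 with rfl | ha
      · simpa [qBinom, qPoch] using isNonnegPoly_one
      · rw [qBinom, if_neg (by push_cast; omega)]; exact isNonnegPoly_zero
    | succ n ih =>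
      rcases lt_or_ge a 0 with ha | ha
      · rw [qBinom, if_neg (by omega)]; exact isNonnegPoly_zero
      · push_cast
        rw [(isGeneric_X.pow hm).qBinom_add_one n.cast_nonneg]
        lift a to ℕ using ha
        refine (ih _).add (IsNonnegPoly.mul ?_ (ih _))
        rw [zpow_natCast, ← pow_mul]
        exact isNonnegPoly_X_pow _

lemma isNonnegPoly_qPoch (n : ℕ) :
    IsNonnegPoly (qPoch (-(RatFunc.X : RatFunc ℚ)) (RatFunc.X ^ 2) n) := by
  induction n with
  | zero => simpa [qPoch] using isNonnegPoly_one
  | succ n ih =>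
    rw [qPoch, Finset.prod_range_succ]
    refine IsNonnegPoly.mul ih ?_
    rw [neg_mul, sub_neg_eq_add, ← pow_mul, ← pow_succ']
    exact isNonnegPoly_one.add (isNonnegPoly_X_pow _)

lemma isNonnegPoly_pow_mul_qPoch (n : ℕ) :
    IsNonnegPoly ((RatFunc.X : RatFunc ℚ) ^ n * qPoch (-(RatFunc.X : RatFunc ℚ)⁻¹)
      (RatFunc.X ^ 2) n) := by
  cases n with
  | zero => simpa [qPoch] using isNonnegPoly_one
  | succ n =>
    have hX : (RatFunc.X : RatFunc ℚ) ≠ 0 := RatFunc.X_ne_zero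
    rw [qPoch_neg_inv_succ hX, show (RatFunc.X : RatFunc ℚ) ^ (n + 1) *
        ((1 + RatFunc.X⁻¹) * qPoch (-RatFunc.X) (RatFunc.X ^ 2) n) =
        (RatFunc.X ^ (n + 1) + RatFunc.X ^ n) * qPoch (-RatFunc.X) (RatFunc.X ^ 2) n by
      field_simp
      ring]
    exact ((isNonnegPoly_X_pow _).add (isNonnegPoly_X_pow _)).mul
      (isNonnegPoly_qPoch n)

end Nonnegativity

theorem lemma4 :
    (∀ (K : Type*) [Field K] (q : K), q ≠ 0 → (∀ n : ℕ, 0 < n → q ^ n ≠ 1) →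
      ∀ L j : ℤ,
        (∑ r ∈ parityRange L j,
            q ^ (L - r) * qPoch (-q⁻¹) (q ^ 2) (L - r).toNat *
              qBinom (q ^ 2) L r * qBinom (q ^ 4) r ((r - j) / 2)
          = qBinom q (2 * L) (L - j)) ∧
        ((2 : K) ≠ 0 →
          ∑ r ∈ parityRange L j,
            q ^ r / (1 + q ^ (2 * r)) * qPoch (-q) (q ^ 2) (L - r).toNat *
              qBinom (q ^ 2) L r * qBinom (q ^ 4) r ((r - j) / 2)
          = q ^ j / (1 + q ^ (2 * j)) * qBinom q (2 * L) (L - j))) ∧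
    (∀ L r : ℤ, 0 ≤ r → r ≤ L →
      IsNonnegPoly
        ((RatFunc.X : RatFunc ℚ) ^ (L - r) *
          qPoch (-(RatFunc.X : RatFunc ℚ)⁻¹) (RatFunc.X ^ 2) (L - r).toNat *
          qBinom ((RatFunc.X : RatFunc ℚ) ^ 2) L r) ∧
      IsNonnegPoly
        (qPoch (-(RatFunc.X : RatFunc ℚ)) (RatFunc.X ^ 2) (L - r).toNat *
          qBinom ((RatFunc.X : RatFunc ℚ) ^ 2) L r)) := by
  refine ⟨fun K _ q hq hroot L j => ?_, fun L r _ hrL => ?_⟩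
  · have h : IsGeneric q := ⟨hq, hroot⟩
    refine ⟨?_, fun h2 => ?_⟩
    · rw [← h.plainSum_eq, plainSum, sum_parityRange]
      simp only [plainKernel_eq]
    · rw [← h.twistedSum_eq h2, twistedSum, sum_parityRange]
      simp only [twistedKernel_eq, mul_assoc]
  · refine ⟨IsNonnegPoly.mul ?_ (isNonnegPoly_qBinom (by norm_num) L r),
      (isNonnegPoly_qPoch _).mul (isNonnegPoly_qBinom (by norm_num) L r)⟩
    have : L - r = ((L - r).toNat : ℤ) := by omega
    rw [this, zpow_natCast, Int.toNat_natCast]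
    exact isNonnegPoly_pow_mul_qPoch _
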